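/- Let $k$ be a field and let $S$ be the polynomial ring over $k$ in finitely many variables with its standard $\mathbb{Z}$-grading. Let $I\subset S$ be an ideal minimally generated by $t$ squarefree monomials $\mu_1,\dots,\mu_t$, all of the same degree $d$. Let $\beta_{i,a}(I)$ denote the number of summands $S(-a)$ in homological degree $i$ of a minimal $\mathbb{Z}$-graded free resolution $\cdots\to F_1\to F_0\to I\to 0$, and let $$\beta^T_{i,a}(I)=\bigl|\{W\subseteq\{1,\dots,t\} : |W|=i+1,\ \deg \operatorname{lcm}_{k\in W}\mu_k=a\}\bigr|$$ be the corresponding Betti number of the Taylor resolution of $I$. Let $(t_1,t_2)$ be a nearly even $2$-partition of $t$, i.e. non-negative integers with $t_1+t_2=t$ and $|t_1-t_2|\le 1$. Then $$\beta_{2,3d-1}(I)\le \binom{t}{3}-\binom{t_1}{3}-\binom{t_2}{3}\qquad\text{and}\qquad \beta^T_{2,3d-1}(I)\le \binom{t}{3}-\binom{t_1}{3}-\binom{t_2}{3}.$$ Moreover, for every $t$ and every nearly even $2$-partition $(t_1,t_2)$ of $t$, the bound is attained for $d=2$, both by $\beta_{2,5}$ and by $\beta^T_{2,5}$: the ideal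 $(u_1v_1,\dots,u_1v_{t_1},u_2w_1,\dots,u_2w_{t_2})$ in $k[u_1,u_2,v_1,\dots,v_{t_1},w_1,\dots,w_{t_2}]$ is minimally generated by $t$ squarefree monomials of degree $2$, has a minimal graded free resolution, and satisfies $$\beta_{2,5}=\beta^T_{2,5}=\binom{t}{3}-\binom{t_1}{3}-\binom{t_2}{3}.$$ -/

import Mathlib

/-- A finite hypergraph whose vertices are the elements of `σ` and in which no edge is contained in
another one (edges of any cardinality and isolated vertices are allowed). -/
structure Clutter (σ : Type*) where
  /-- the edges -/
  edges : Finset (Finset σ)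
  antichain : IsAntichain (· ⊆ ·) (edges : Set (Finset σ))

/-- The exponent vector of the squarefree monomial `∏ x ∈ F, X x`. -/
noncomputable def sqfreeExponent {σ : Type*} (F : Finset σ) : σ →₀ ℕ :=
  ∑ x ∈ F, Finsupp.single x 1

namespace Clutter

variable {σ : Type*}

/-- All edges of `G` have exactly `d` elements. -/
def IsPureOfDegree (G : Clutter σ) (d : ℕ) : Prop :=
  ∀ F ∈ G.edges, F.card = d

/-- The edge ideal of `G` in the polynomial ring over `k` whose variables are the vertices.
The monomials of the edges are its minimal monomial generators, and every squarefree monomial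
ideal in finitely many variables is the edge ideal of exactly one hypergraph. -/
noncomputable def edgeIdeal (k : Type*) [Field k] (G : Clutter σ) :
    Ideal (MvPolynomial σ k) :=
  Ideal.span {p | ∃ F ∈ G.edges, p = MvPolynomial.monomial (sqfreeExponent F) 1}

/-- The graded Betti number `β^T_{i,a}` of the Taylor resolution of the edge ideal of `G`. The
free module of that resolution in homological degree `i` has one basis element for each set `W` of
`i + 1` minimal generators, placed in degree `deg lcm W`. The lcm of monomials is the supremum
of their exponent vectors. -/
noncomputable def taylorBetti (G : Clutter σ) (i : ℕ) (a : ℤ) : ℕ :=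
  ((G.edges.powersetCard (i + 1)).filter
    fun W => ((W.sup sqfreeExponent).degree : ℤ) = a).card

/-- The disjoint union of two stars: vertices `u₁, u₂, v₁, …, v_{t₁}, w₁, …, w_{t₂}`
and edges `{u₁, vᵢ}` and `{u₂, wⱼ}`. -/
def doubleStar (t₁ t₂ : ℕ) : Clutter (Fin 2 ⊕ (Fin t₁ ⊕ Fin t₂)) where
  edges :=
    (Finset.univ.image fun i : Fin t₁ => {Sum.inl 0, Sum.inr (Sum.inl i)}) ∪
    (Finset.univ.image fun j : Fin t₂ => {Sum.inl 1, Sum.inr (Sum.inr j)})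
  antichain := by
    have key : ∀ F ∈ (Finset.univ.image fun i : Fin t₁ =>
          ({Sum.inl 0, Sum.inr (Sum.inl i)} : Finset (Fin 2 ⊕ (Fin t₁ ⊕ Fin t₂)))) ∪
        (Finset.univ.image fun j : Fin t₂ => {Sum.inl 1, Sum.inr (Sum.inr j)}),
        F.card = 2 := by
      intro F hF
      simp only [Finset.mem_union, Finset.mem_image, Finset.mem_univ, true_and] at hF
      rcases hF with ⟨i, rfl⟩ | ⟨j, rfl⟩ <;> exact Finset.card_pair (by simp)
    intro A hA B hB hne hsub
    exact hne (Finset.eq_of_subset_of_card_le hsub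
      (by rw [key A (Finset.mem_coe.1 hA), key B (Finset.mem_coe.1 hB)]))

end Clutter

/-- `p` is homogeneous of the integer degree `e` (zero is homogeneous of every degree). -/
def IsHomogeneousOfIntDegree {σ k : Type*} [Field k] (p : MvPolynomial σ k) (e : ℤ) : Prop :=
  ∀ m : σ →₀ ℕ, MvPolynomial.coeff m p ≠ 0 → (m.degree : ℤ) = e

/-- A minimal `ℤ`-graded free resolution
`⋯ → F₂ → F₁ → F₀ → I → 0` of an ideal `I` of the standard graded polynomial ring
`S = k[σ]`, where `Fᵢ = ⨁_b S(-deg i b)` has finite rank `rank i`. -/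
structure MinimalGradedFreeResolution {σ k : Type*} [Field k]
    (I : Ideal (MvPolynomial σ k)) where
  /-- the rank of `Fᵢ` -/
  rank : ℕ → ℕ
  /-- the degree of the `b`-th basis element of `Fᵢ` -/
  deg : ∀ i, Fin (rank i) → ℤ
  /-- the differential `Fᵢ₊₁ → Fᵢ` -/
  d : ∀ i, (Fin (rank (i + 1)) → MvPolynomial σ k) →ₗ[MvPolynomial σ k]
    (Fin (rank i) → MvPolynomial σ k)
  /-- the augmentation `F₀ → I ⊆ S` -/
  aug : (Fin (rank 0) → MvPolynomial σ k) →ₗ[MvPolynomial σ k] MvPolynomial σ k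
  /-- the differentials preserve degrees -/
  d_homogeneous : ∀ i b c, IsHomogeneousOfIntDegree (d i (Pi.single b 1) c)
    (deg (i + 1) b - deg i c)
  /-- the augmentation preserves degrees -/
  aug_homogeneous : ∀ b, IsHomogeneousOfIntDegree (aug (Pi.single b 1)) (deg 0 b)
  range_aug : LinearMap.range aug = I
  exact_zero : Function.Exact (d 0) aug
  exact_succ : ∀ i, Function.Exact (d (i + 1)) (d i)
  /-- minimality: the image of each differential lies in `𝔪 Fᵢ`, where `𝔪` is the ideal
  generated by the variables -/
  minimal : ∀ i b c, MvPolynomial.constantCoeff (d i (Pi.single b 1) c) = 0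

/-- The number of summands `S(-a)` of `Fᵢ`. Minimal resolutions of `I` being isomorphic, this is
the graded Betti number `β_{i,a}(I)`, whichever minimal resolution of `I` is used. -/
def MinimalGradedFreeResolution.betti {σ k : Type*} [Field k]
    {I : Ideal (MvPolynomial σ k)} (R : MinimalGradedFreeResolution I) (i : ℕ) (a : ℤ) : ℕ :=
  (Finset.univ.filter fun b : Fin (R.rank i) => R.deg i b = a).card

/-- `p` is a nearly even `m`-partition of `r`: the parts sum to `r`, and any two of them differ
by at most one. -/
def IsNearlyEvenPartition {m : ℕ} (r : ℕ) (p : Fin m → ℕ) : Prop :=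
  ∑ i, p i = r ∧ ∀ i j, i < j → |(p i : ℤ) - (p j : ℤ)| ≤ 1

/-!
The Betti numbers of an ideal are at most those of its Taylor resolution, so the bound is a
statement about the triples of generators whose lcm has degree `3 d - 1`. By inclusion and exclusion
these are triples of `d`-element sets with exactly one intersecting pair, that is, triples of
vertices spanning exactly one edge in the intersection graph of the generators.

The number of such triples is bounded by a refinement of Goodman's argument. Summing
`deg x * (t - 1 - deg x)` over the vertices counts the triples spanning one or two edges, twice
each. For `t = 2m` the estimate `deg x * (t - 1 - deg x) ≤ m (m - 1)` is enough. For `t = 2m + 1` it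
would give only `deg x * (t - 1 - deg x) ≤ m ^ 2`, and a total loss of `m` has to be found among the
degrees different from `m` and the triples spanning two edges; see
`SimpleGraph.sum_oneEdgeCount_le_of_card_eq_two_mul_add_one`.

The comparison with the Taylor resolution (`GradedExactComplex.IsMinimal.rankInDegree_le`) is the
usual one: graded chain maps in both directions lift the identity, their composite on the minimal
resolution is homotopic to the identity, and modulo the variables the homotopy disappears. The
Taylor complex is exact (`exists_taylorMap_eq`) because each of its multigraded strands is the chain
complex of a full simplex, which a cone contracts.

In the double star every edge has a leaf that lies in no other edge. Hence the Taylor resolution is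
minimal, which yields the existence of a minimal resolution and the equality of both Betti numbers.
The triples with an lcm of degree `5` are those that meet both stars.
-/

open MvPolynomial

/-! ### Homogeneous polynomials of integer degree -/

section Homogeneous

variable {σ k : Type*} [Field k]

namespace IsHomogeneousOfIntDegree

theorem zero (e : ℤ) : IsHomogeneousOfIntDegree (0 : MvPolynomial σ k) e :=
  fun m hm => absurd (coeff_zero m) hm

theorem sum {ι : Type*} {s : Finset ι} {p : ι → MvPolynomial σ k} {e : ℤ}
    (h : ∀ i ∈ s, IsHomogeneousOfIntDegree (p i) e) :
    IsHomogeneousOfIntDegree (∑ i ∈ s, p i) e := by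
  intro m hm
  rw [coeff_sum] at hm
  obtain ⟨i, hi, hi'⟩ := Finset.exists_ne_zero_of_sum_ne_zero hm
  exact h i hi m hi'

theorem mul {p q : MvPolynomial σ k} {e f : ℤ} (hp : IsHomogeneousOfIntDegree p e)
    (hq : IsHomogeneousOfIntDegree q f) : IsHomogeneousOfIntDegree (p * q) (e + f) := by
  classical
  intro m hm
  rw [coeff_mul] at hm
  obtain ⟨⟨i, j⟩, hij, hne⟩ := Finset.exists_ne_zero_of_sum_ne_zero hm
  have hij : i + j = m := Finset.HasAntidiagonal.mem_antidiagonal.1 hij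
  rw [← hij, map_add, Nat.cast_add, hp i (left_ne_zero_of_mul hne),
    hq j (right_ne_zero_of_mul hne)]

theorem monomial (m : σ →₀ ℕ) (c : k) :
    IsHomogeneousOfIntDegree (MvPolynomial.monomial m c) (m.degree : ℤ) := by
  classical
  intro n hn
  rw [coeff_monomial] at hn
  split_ifs at hn with h
  · rw [h]
  · exact absurd rfl hn

/-- A homogeneous polynomial with a constant term has degree zero. -/
theorem eq_zero_of_constantCoeff_ne_zero {p : MvPolynomial σ k} {e : ℤ}
    (hp : IsHomogeneousOfIntDegree p e) (h : constantCoeff p ≠ 0) : e = 0 := by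
  simpa using (hp 0 h).symm

end IsHomogeneousOfIntDegree

/-- The component of `p` of integer degree `e`; it vanishes for negative `e`. -/
noncomputable def intComponent (e : ℤ) (p : MvPolynomial σ k) : MvPolynomial σ k :=
  if 0 ≤ e then homogeneousComponent e.toNat p else 0

theorem coeff_intComponent (e : ℤ) (p : MvPolynomial σ k) (m : σ →₀ ℕ) :
    coeff m (intComponent e p) = if (m.degree : ℤ) = e then coeff m p else 0 := by
  unfold intComponent
  split_ifs with h h' h'
  · rw [coeff_homogeneousComponent, if_pos (by omega)]
  · rw [coeff_homogeneousComponent, if_neg (by omega)]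
  · omega
  · simp

theorem isHomogeneousOfIntDegree_intComponent (e : ℤ) (p : MvPolynomial σ k) :
    IsHomogeneousOfIntDegree (intComponent e p) e := by
  intro m hm
  rw [coeff_intComponent] at hm
  by_contra h
  exact hm (if_neg h)

theorem IsHomogeneousOfIntDegree.intComponent_eq {p : MvPolynomial σ k} {e : ℤ}
    (hp : IsHomogeneousOfIntDegree p e) : intComponent e p = p := by
  ext m
  rw [coeff_intComponent, ite_eq_left_iff]
  intro h
  by_contra h'
  exact h (hp m (Ne.symm h'))

theorem intComponent_sum {ι : Type*} (s : Finset ι) (e : ℤ) (p : ι → MvPolynomial σ k) :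
    intComponent e (∑ i ∈ s, p i) = ∑ i ∈ s, intComponent e (p i) := by
  ext m
  simp only [coeff_intComponent, coeff_sum]
  split_ifs <;> simp

theorem intComponent_mul (e : ℤ) (p : MvPolynomial σ k) {q : MvPolynomial σ k} {f : ℤ}
    (hq : IsHomogeneousOfIntDegree q f) :
    intComponent e (p * q) = intComponent (e - f) p * q := by
  classical
  ext m
  have key : ∀ x ∈ Finset.HasAntidiagonal.antidiagonal m,
      coeff x.1 (intComponent (e - f) p) * coeff x.2 q =
        if (m.degree : ℤ) = e then coeff x.1 p * coeff x.2 q else 0 := by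
    rintro ⟨i, j⟩ hij
    have hij : i + j = m := Finset.HasAntidiagonal.mem_antidiagonal.1 hij
    rw [coeff_intComponent, ← hij, map_add, Nat.cast_add]
    by_cases hj : coeff j q = 0
    · simp [hj]
    · simp only [hq j hj, ite_mul, zero_mul, eq_sub_iff_add_eq]
  rw [coeff_intComponent, coeff_mul, coeff_mul, Finset.sum_congr rfl key]
  split_ifs <;> simp

end Homogeneous

/-! ### Graded linear maps between graded free modules -/

section GradedMap

variable {σ k ι κ ν : Type*} [Field k] [DecidableEq ι]

/-- The linear map `f` from `⨁ᵢ S(-a i)` to `⨁ⱼ S(-b j)` preserves degrees. -/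
def IsGradedMap (a : ι → ℤ) (b : κ → ℤ)
    (f : (ι → MvPolynomial σ k) →ₗ[MvPolynomial σ k] (κ → MvPolynomial σ k)) : Prop :=
  ∀ i j, IsHomogeneousOfIntDegree (f (Pi.single i 1) j) (a i - b j)

theorem LinearMap.apply_eq_sum_mul_single {R : Type*} [CommSemiring R] [Fintype ι]
    (f : (ι → R) →ₗ[R] (κ → R)) (x : ι → R) (j : κ) :
    f x j = ∑ i, x i * f (Pi.single i 1) j := by
  conv_lhs => rw [pi_eq_sum_univ' x]
  simp [map_sum, map_smul, Finset.sum_apply]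

/-- A map out of a finite free module lifts through `δ` once its range does. -/
theorem LinearMap.exists_comp_eq_of_range_le {R M N : Type*} [CommRing R] [AddCommGroup M]
    [AddCommGroup N] [Module R M] [Module R N] [Finite ι] (f : (ι → R) →ₗ[R] N) (δ : M →ₗ[R] N)
    (h : LinearMap.range f ≤ LinearMap.range δ) : ∃ g : (ι → R) →ₗ[R] M, δ ∘ₗ g = f := by
  choose y hy using fun i => h (LinearMap.mem_range_self f (Pi.single i 1))
  refine ⟨(Pi.basisFun R ι).constr R y, (Pi.basisFun R ι).ext fun i => ?_⟩
  rw [LinearMap.comp_apply, Module.Basis.constr_basis, hy, Pi.basisFun_apply]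

variable [Fintype κ] [DecidableEq κ]

/-- The graded form of `LinearMap.exists_comp_eq_of_range_le`: arbitrary preimages of the basis
elements may be replaced by their homogeneous components of the right degree. -/
theorem IsGradedMap.exists_lift [Fintype ι] {a : ι → ℤ} {b : κ → ℤ} {c : ν → ℤ}
    {f : (ι → MvPolynomial σ k) →ₗ[MvPolynomial σ k] (ν → MvPolynomial σ k)}
    {δ : (κ → MvPolynomial σ k) →ₗ[MvPolynomial σ k] (ν → MvPolynomial σ k)}
    (hf : IsGradedMap a c f) (hδ : IsGradedMap b c δ)
    (h : LinearMap.range f ≤ LinearMap.range δ) :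
    ∃ g : (ι → MvPolynomial σ k) →ₗ[MvPolynomial σ k] (κ → MvPolynomial σ k),
      IsGradedMap a b g ∧ δ ∘ₗ g = f := by
  choose y hy using fun i => h (LinearMap.mem_range_self f (Pi.single i 1))
  set B := Pi.basisFun (MvPolynomial σ k) ι
  set z : ι → κ → MvPolynomial σ k := fun i j => intComponent (a i - b j) (y i j)
  have hz : ∀ i, B.constr (MvPolynomial σ k) z (Pi.single i 1) = z i := fun i => by
    rw [← B.constr_basis (MvPolynomial σ k) z i, Pi.basisFun_apply]
  refine ⟨B.constr (MvPolynomial σ k) z, fun i j => ?_, B.ext fun i => funext fun l => ?_⟩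
  · rw [hz]
    exact isHomogeneousOfIntDegree_intComponent _ _
  · rw [Pi.basisFun_apply, LinearMap.comp_apply, hz, ← (hf i l).intComponent_eq, ← hy,
      LinearMap.apply_eq_sum_mul_single, LinearMap.apply_eq_sum_mul_single, intComponent_sum]
    refine Finset.sum_congr rfl fun j _ => ?_
    rw [intComponent_mul _ _ (hδ j l), sub_sub_sub_cancel_right]

theorem IsGradedMap.comp {a : ι → ℤ} {b : κ → ℤ} {c : ν → ℤ}
    {g : (κ → MvPolynomial σ k) →ₗ[MvPolynomial σ k] (ν → MvPolynomial σ k)}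
    {f : (ι → MvPolynomial σ k) →ₗ[MvPolynomial σ k] (κ → MvPolynomial σ k)}
    (hg : IsGradedMap b c g) (hf : IsGradedMap a b f) : IsGradedMap a c (g ∘ₗ f) := by
  intro i l
  rw [LinearMap.comp_apply, LinearMap.apply_eq_sum_mul_single]
  refine IsHomogeneousOfIntDegree.sum fun j _ => ?_
  have := (hf i j).mul (hg j l)
  rwa [sub_add_sub_cancel] at this

theorem constantCoeff_apply_eq_sum
    (f : (κ → MvPolynomial σ k) →ₗ[MvPolynomial σ k] (ν → MvPolynomial σ k))
    (x : κ → MvPolynomial σ k) (l : ν) :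
    constantCoeff (f x l) =
      ∑ j, constantCoeff (x j) * constantCoeff (f (Pi.single j 1) l) := by
  rw [LinearMap.apply_eq_sum_mul_single, map_sum]
  exact Finset.sum_congr rfl fun j _ => map_mul _ _ _

end GradedMap

/-! ### Exact complexes of graded free modules -/

/-- An exact complex `⋯ → X₂ → X₁ → X₀` of graded free modules of finite rank over `k[σ]`; nothing
is required at `X₀`. An augmented free resolution of an ideal is such a complex with
`X₀ = S`, and the free modules `F₀, F₁, …` of the resolution are `X₁, X₂, …`. -/
structure GradedExactComplex (σ k : Type*) [Field k] where
  /-- the basis of the `n`-th module -/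
  ι : ℕ → Type*
  [fintype : ∀ n, Fintype (ι n)]
  [decidableEq : ∀ n, DecidableEq (ι n)]
  /-- the degrees of the basis elements -/
  deg : ∀ n, ι n → ℤ
  /-- the differential -/
  d : ∀ n, (ι (n + 1) → MvPolynomial σ k) →ₗ[MvPolynomial σ k] (ι n → MvPolynomial σ k)
  d_graded : ∀ n, IsGradedMap (deg (n + 1)) (deg n) (d n)
  exact : ∀ n, Function.Exact (d (n + 1)) (d n)

namespace GradedExactComplex

attribute [instance] GradedExactComplex.fintype GradedExactComplex.decidableEq

variable {σ k : Type*} [Field k]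

/-- The number of basis elements of degree `a` of the `n`-th module. -/
def rankInDegree (X : GradedExactComplex σ k) (n : ℕ) (a : ℤ) : ℕ :=
  Fintype.card {b : X.ι n // X.deg n b = a}

/-- The matrices of the differentials, except possibly the last one, have entries in the ideal
generated by the variables. -/
def IsMinimal (X : GradedExactComplex σ k) : Prop :=
  ∀ n b c, constantCoeff (X.d (n + 1) (Pi.single b 1) c) = 0

theorem range_le_range_d (X : GradedExactComplex σ k) {M : Type*} [AddCommGroup M]
    [Module (MvPolynomial σ k) M] (n : ℕ)
    (f : M →ₗ[MvPolynomial σ k] (X.ι (n + 1) → MvPolynomial σ k)) (h : X.d n ∘ₗ f = 0) :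
    LinearMap.range f ≤ LinearMap.range (X.d (n + 1)) := by
  rintro _ ⟨x, rfl⟩
  exact (X.exact n _).1 (LinearMap.congr_fun h x)

theorem d_comp_d (X : GradedExactComplex σ k) (n : ℕ) : X.d n ∘ₗ X.d (n + 1) = 0 :=
  LinearMap.ext fun x => (X.exact n).apply_apply_eq_zero x

/-- Comparison: a graded map in position `0` that is compatible with the images of the last
differentials extends to a graded chain map. -/
theorem exists_chainMap (X Y : GradedExactComplex σ k)
    (f₀ : (X.ι 0 → MvPolynomial σ k) →ₗ[MvPolynomial σ k] (Y.ι 0 → MvPolynomial σ k))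
    (hf₀ : IsGradedMap (X.deg 0) (Y.deg 0) f₀)
    (h : LinearMap.range (f₀ ∘ₗ X.d 0) ≤ LinearMap.range (Y.d 0)) :
    ∃ f : ∀ n, (X.ι n → MvPolynomial σ k) →ₗ[MvPolynomial σ k] (Y.ι n → MvPolynomial σ k),
      f 0 = f₀ ∧ (∀ n, IsGradedMap (X.deg n) (Y.deg n) (f n)) ∧
        ∀ n, Y.d n ∘ₗ f (n + 1) = f n ∘ₗ X.d n := by
  let State (n : ℕ) : Type _ :=
    {p : ((X.ι n → MvPolynomial σ k) →ₗ[MvPolynomial σ k] (Y.ι n → MvPolynomial σ k)) ×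
        ((X.ι (n + 1) → MvPolynomial σ k) →ₗ[MvPolynomial σ k]
          (Y.ι (n + 1) → MvPolynomial σ k)) //
      IsGradedMap (X.deg n) (Y.deg n) p.1 ∧ IsGradedMap (X.deg (n + 1)) (Y.deg (n + 1)) p.2 ∧
        Y.d n ∘ₗ p.2 = p.1 ∘ₗ X.d n}
  have step : ∀ n (p : State n), ∃ q : State (n + 1), q.1.1 = p.1.2 := by
    rintro n ⟨⟨f, g⟩, -, hg, hfg⟩
    obtain ⟨e, he, he'⟩ := (hg.comp (X.d_graded (n + 1))).exists_lift (Y.d_graded (n + 1))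
      (Y.range_le_range_d n _ (by
        rw [← LinearMap.comp_assoc, hfg, LinearMap.comp_assoc, X.d_comp_d, LinearMap.comp_zero]))
    exact ⟨⟨(g, e), hg, he, he'⟩, rfl⟩
  choose next hnext using step
  obtain ⟨f₁, hf₁, hf₁'⟩ := (hf₀.comp (X.d_graded 0)).exists_lift (Y.d_graded 0) h
  let s : ∀ n, State n := fun n => Nat.rec ⟨(f₀, f₁), hf₀, hf₁, hf₁'⟩ next n
  refine ⟨fun n => (s n).1.1, rfl, fun n => (s n).2.1, fun n => ?_⟩
  have hs : (s (n + 1)).1.1 = (s n).1.2 := hnext n (s n)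
  dsimp only
  rw [hs]
  exact (s n).2.2.2

/-- A chain endomorphism that vanishes in position `0` is null-homotopic. -/
theorem exists_homotopy (X : GradedExactComplex σ k)
    (f : ∀ n, (X.ι n → MvPolynomial σ k) →ₗ[MvPolynomial σ k] (X.ι n → MvPolynomial σ k))
    (hf₀ : f 0 = 0) (hf : ∀ n, X.d n ∘ₗ f (n + 1) = f n ∘ₗ X.d n) :
    ∃ h : ∀ n, (X.ι n → MvPolynomial σ k) →ₗ[MvPolynomial σ k] (X.ι (n + 1) → MvPolynomial σ k),
      h 0 = 0 ∧ ∀ n, f (n + 1) = X.d (n + 1) ∘ₗ h (n + 1) + h n ∘ₗ X.d n := by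
  let State (n : ℕ) : Type _ :=
    {p : ((X.ι n → MvPolynomial σ k) →ₗ[MvPolynomial σ k] (X.ι (n + 1) → MvPolynomial σ k)) ×
        ((X.ι (n + 1) → MvPolynomial σ k) →ₗ[MvPolynomial σ k]
          (X.ι (n + 1 + 1) → MvPolynomial σ k)) //
      f (n + 1) = X.d (n + 1) ∘ₗ p.2 + p.1 ∘ₗ X.d n}
  have step : ∀ n (p : State n), ∃ q : State (n + 1), q.1.1 = p.1.2 := by
    rintro n ⟨⟨h, h'⟩, hh⟩
    dsimp only at hh
    obtain ⟨e, he⟩ := LinearMap.exists_comp_eq_of_range_le (f (n + 2) - h' ∘ₗ X.d (n + 1))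
      (X.d (n + 2)) (X.range_le_range_d (n + 1) _ (by
        rw [LinearMap.comp_sub, hf, hh, LinearMap.add_comp, LinearMap.comp_assoc _ _ h,
          X.d_comp_d, LinearMap.comp_zero, add_zero, LinearMap.comp_assoc, sub_self]))
    exact ⟨⟨(h', e), (sub_eq_iff_eq_add.1 he.symm)⟩, rfl⟩
  choose next hnext using step
  obtain ⟨h₁, hh₁⟩ := LinearMap.exists_comp_eq_of_range_le (f 1) (X.d 1)
    (X.range_le_range_d 0 _ (by rw [hf, hf₀, LinearMap.zero_comp]))
  let s : ∀ n, State n := fun n =>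
    Nat.rec ⟨(0, h₁), by rw [hh₁, LinearMap.zero_comp, add_zero]⟩ next n
  refine ⟨fun n => (s n).1.1, rfl, fun n => ?_⟩
  have hs : (s (n + 1)).1.1 = (s n).1.2 := hnext n (s n)
  dsimp only
  rw [hs]
  exact (s n).2

/-- The minimal complex `X` is a direct summand of `Y` modulo the variables, so it has at most as
many basis elements in each degree. -/
theorem IsMinimal.rankInDegree_le {X Y : GradedExactComplex σ k} (hX : X.IsMinimal)
    (f₀ : (X.ι 0 → MvPolynomial σ k) →ₗ[MvPolynomial σ k] (Y.ι 0 → MvPolynomial σ k))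
    (g₀ : (Y.ι 0 → MvPolynomial σ k) →ₗ[MvPolynomial σ k] (X.ι 0 → MvPolynomial σ k))
    (hf₀ : IsGradedMap (X.deg 0) (Y.deg 0) f₀) (hg₀ : IsGradedMap (Y.deg 0) (X.deg 0) g₀)
    (hgf : g₀ ∘ₗ f₀ = LinearMap.id)
    (hf : LinearMap.range (f₀ ∘ₗ X.d 0) ≤ LinearMap.range (Y.d 0))
    (hg : LinearMap.range (g₀ ∘ₗ Y.d 0) ≤ LinearMap.range (X.d 0)) (n : ℕ) (a : ℤ) :
    X.rankInDegree (n + 1) a ≤ Y.rankInDegree (n + 1) a := by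
  obtain ⟨f, hf0, hfg, hfd⟩ := exists_chainMap X Y f₀ hf₀ hf
  obtain ⟨g, hg0, -, hgd⟩ := exists_chainMap Y X g₀ hg₀ hg
  obtain ⟨h, hh0, hh⟩ := X.exists_homotopy (fun n => g n ∘ₗ f n - LinearMap.id)
    (by simp only [hf0, hg0, hgf, sub_self]) (fun n => by
      simp only [LinearMap.comp_sub, LinearMap.sub_comp, LinearMap.comp_id, LinearMap.id_comp]
      rw [← LinearMap.comp_assoc, hgd, LinearMap.comp_assoc, hfd, LinearMap.comp_assoc])
  -- modulo the variables, both summands of the homotopy vanish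
  have hcc : ∀ b c, constantCoeff (g (n + 1) (f (n + 1) (Pi.single b 1)) c) =
      if b = c then 1 else 0 := by
    intro b c
    have h1 := congrArg constantCoeff (congrFun (LinearMap.congr_fun (hh n) (Pi.single b 1)) c)
    simp only [LinearMap.sub_apply, LinearMap.add_apply, LinearMap.comp_apply, Pi.sub_apply,
      Pi.add_apply, map_sub, map_add, LinearMap.id_apply] at h1
    rw [constantCoeff_apply_eq_sum (X.d (n + 1)), constantCoeff_apply_eq_sum (h n),
      Finset.sum_eq_zero fun j _ => by rw [hX, mul_zero], zero_add,
      Finset.sum_eq_zero fun j _ => ?_, sub_eq_zero] at h1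
    · rw [h1, Pi.single_apply]
      simp [eq_comm, apply_ite constantCoeff]
    · cases n with
      | zero => simp [hh0]
      | succ n => rw [hX, zero_mul]
  let F : Matrix {b // X.deg (n + 1) b = a} {b // Y.deg (n + 1) b = a} k :=
    fun b j => constantCoeff (f (n + 1) (Pi.single b.1 1) j.1)
  let G : Matrix {b // Y.deg (n + 1) b = a} {b // X.deg (n + 1) b = a} k :=
    fun j c => constantCoeff (g (n + 1) (Pi.single j.1 1) c.1)
  have hFG : F * G = 1 := by
    ext b c
    rw [Matrix.mul_apply, Matrix.one_apply]
    simp only [Subtype.ext_iff]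
    rw [← hcc b.1 c.1, constantCoeff_apply_eq_sum]
    rw [← Finset.sum_filter_of_ne (p := fun j => Y.deg (n + 1) j = a)]
    · exact (Finset.sum_subtype _ (fun j => by simp) fun j =>
        constantCoeff (f (n + 1) (Pi.single b.1 1) j) *
          constantCoeff (g (n + 1) (Pi.single j 1) c.1)).symm
    · intro j _ hj
      have := (hfg (n + 1) b.1 j).eq_zero_of_constantCoeff_ne_zero (left_ne_zero_of_mul hj)
      rw [← b.2]
      omega
  calc X.rankInDegree (n + 1) a = (F * G).rank := by
        rw [hFG, Matrix.rank_one]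
        rfl
    _ ≤ F.rank := Matrix.rank_mul_le_left _ _
    _ ≤ Y.rankInDegree (n + 1) a := F.rank_le_card_width

end GradedExactComplex

namespace MinimalGradedFreeResolution

variable {σ k : Type*} [Field k] {I : Ideal (MvPolynomial σ k)}

/-- The augmented resolution `⋯ → F₁ → F₀ → S`. -/
noncomputable def augmented (R : MinimalGradedFreeResolution I) :
    GradedExactComplex.{_, _, 0} σ k where
  ι n := match n with
    | 0 => Unit
    | n + 1 => Fin (R.rank n)
  fintype n := match n with
    | 0 => inferInstanceAs (Fintype Unit)
    | n + 1 => inferInstanceAs (Fintype (Fin (R.rank n)))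
  decidableEq n := match n with
    | 0 => inferInstanceAs (DecidableEq Unit)
    | n + 1 => inferInstanceAs (DecidableEq (Fin (R.rank n)))
  deg n := match n with
    | 0 => fun _ => 0
    | n + 1 => R.deg n
  d n := match n with
    | 0 => LinearMap.pi fun _ => R.aug
    | n + 1 => R.d n
  d_graded n := match n with
    | 0 => fun b _ => by
      rw [sub_zero]
      exact R.aug_homogeneous b
    | n + 1 => R.d_homogeneous n
  exact n := match n with
    | 0 => fun x => by
      refine Iff.trans ?_ (R.exact_zero x)
      exact ⟨fun h => congrFun h (), fun h => funext fun _ => h⟩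
    | n + 1 => R.exact_succ n

theorem isMinimal_augmented (R : MinimalGradedFreeResolution I) : R.augmented.IsMinimal :=
  R.minimal

theorem rankInDegree_augmented (R : MinimalGradedFreeResolution I) (n : ℕ) (a : ℤ) :
    R.augmented.rankInDegree (n + 1) a = R.betti n a :=
  Fintype.card_subtype _

end MinimalGradedFreeResolution

/-! ### Resolutions of an ideal as exact complexes -/

namespace GradedExactComplex

variable {σ k : Type*} [Field k] {I : Ideal (MvPolynomial σ k)}

/-- The exact complex `X` is an augmented free resolution of `I`: its last module has a single
basis element `o`, of degree zero, and the image of the last differential is `I`. -/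
def Resolves (X : GradedExactComplex σ k) (I : Ideal (MvPolynomial σ k)) : Prop :=
  ∃ o : X.ι 0, (∀ b, b = o) ∧ X.deg 0 o = 0 ∧ ∀ x, x ∈ LinearMap.range (X.d 0) ↔ x o ∈ I

/-- A minimal resolution of `I` has, in each position and degree, at most as many basis elements
as any other graded free resolution of `I`. -/
theorem IsMinimal.rankInDegree_le_of_resolves {X Y : GradedExactComplex σ k} (hX : X.IsMinimal)
    (hXI : X.Resolves I) (hYI : Y.Resolves I) (n : ℕ) (a : ℤ) :
    X.rankInDegree (n + 1) a ≤ Y.rankInDegree (n + 1) a := by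
  obtain ⟨o, ho, hdeg, hrange⟩ := hXI
  obtain ⟨o', ho', hdeg', hrange'⟩ := hYI
  refine hX.rankInDegree_le (LinearMap.funLeft _ _ fun _ => o) (LinearMap.funLeft _ _ fun _ => o')
    ?_ ?_ ?_ ?_ ?_ n a
  · intro b c
    rw [LinearMap.funLeft_apply, ho b, ho' c, hdeg, hdeg', Pi.single_eq_same]
    simpa using IsHomogeneousOfIntDegree.monomial (0 : σ →₀ ℕ) (1 : k)
  · intro b c
    rw [LinearMap.funLeft_apply, ho c, ho' b, hdeg, hdeg', Pi.single_eq_same]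
    simpa using IsHomogeneousOfIntDegree.monomial (0 : σ →₀ ℕ) (1 : k)
  · refine LinearMap.ext fun x => funext fun b => ?_
    rw [ho b]
    rfl
  · rintro _ ⟨x, rfl⟩
    exact (hrange' _).2 ((hrange _).1 (LinearMap.mem_range_self _ x))
  · rintro _ ⟨x, rfl⟩
    exact (hrange _).2 ((hrange' _).1 (LinearMap.mem_range_self _ x))

/-- Enumerating the bases turns a minimal exact complex resolving `I` into a minimal graded free
resolution of `I`. -/
theorem IsMinimal.nonempty_minimalGradedFreeResolution {X : GradedExactComplex σ k}
    (hX : X.IsMinimal) (hXI : X.Resolves I) : Nonempty (MinimalGradedFreeResolution I) := by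
  obtain ⟨o, ho, hdeg, hrange⟩ := hXI
  let e (n : ℕ) := Fintype.equivFin (X.ι (n + 1))
  let L (n : ℕ) := LinearEquiv.funCongrLeft (MvPolynomial σ k) (MvPolynomial σ k) (e n)
  have hL : ∀ n b, L n (Pi.single b 1) = Pi.single ((e n).symm b) 1 := by
    intro n b
    funext c
    simp only [L, LinearEquiv.funCongrLeft_apply, LinearMap.funLeft_apply, Pi.single_apply,
      Equiv.eq_symm_apply]
  have hzero : ∀ x : X.ι 0 → MvPolynomial σ k, x o = 0 → x = 0 := fun x hx =>
    funext fun b => by rw [ho b, hx, Pi.zero_apply]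
  exact ⟨{
    rank := fun n => Fintype.card (X.ι (n + 1))
    deg := fun n b => X.deg (n + 1) ((e n).symm b)
    d := fun n => (L n).symm.toLinearMap ∘ₗ X.d (n + 1) ∘ₗ (L (n + 1)).toLinearMap
    aug := LinearMap.proj o ∘ₗ X.d 0 ∘ₗ (L 0).toLinearMap
    d_homogeneous := fun n b c => by
      have := X.d_graded (n + 1) ((e (n + 1)).symm b) ((e n).symm c)
      rw [← hL] at this
      exact this
    aug_homogeneous := fun b => by
      have := X.d_graded 0 ((e 0).symm b) o
      rw [← hL, hdeg, sub_zero] at this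
      exact this
    range_aug := by
      ext p
      rw [← Pi.single_eq_same (M := fun _ : X.ι 0 => MvPolynomial σ k) o p, ← hrange]
      constructor
      · rintro ⟨x, hx⟩
        refine ⟨L 0 x, funext fun b => ?_⟩
        rw [ho b]
        exact hx
      · rintro ⟨x, hx⟩
        refine ⟨(L 0).symm x, ?_⟩
        simp [hx]
    exact_zero := fun x => by
      have := X.exact 0 (L 0 x)
      constructor
      · intro hx
        obtain ⟨y, hy⟩ := this.1 (hzero _ hx)
        exact ⟨(L 1).symm y, by simp [hy]⟩
      · rintro ⟨y, hy⟩
        have hy' : X.d 1 (L 1 y) = L 0 x := by simp [← hy]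
        exact congrFun (this.2 ⟨_, hy'⟩) o
    exact_succ := fun n x => by
      have := X.exact (n + 1) (L (n + 1) x)
      constructor
      · intro hx
        obtain ⟨y, hy⟩ := this.1 ((L n).symm.map_eq_zero_iff.1 hx)
        exact ⟨(L (n + 2)).symm y, by simp [hy]⟩
      · rintro ⟨y, hy⟩
        have hy' : X.d (n + 2) (L (n + 2) y) = L (n + 1) x := by simp [← hy]
        exact (L n).symm.map_eq_zero_iff.2 (this.2 ⟨_, hy'⟩)
    minimal := fun n b c => by
      have := hX n ((e (n + 1)).symm b) ((e n).symm c)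
      rw [← hL] at this
      exact this }⟩

end GradedExactComplex

theorem MinimalGradedFreeResolution.resolves_augmented {σ k : Type*} [Field k]
    {I : Ideal (MvPolynomial σ k)} (R : MinimalGradedFreeResolution I) :
    R.augmented.Resolves I := by
  refine ⟨(), fun _ => rfl, rfl, fun x => ?_⟩
  refine Iff.trans ?_ (SetLike.ext_iff.1 R.range_aug (x ()))
  exact ⟨fun ⟨y, hy⟩ => ⟨y, congrFun hy ()⟩, fun ⟨y, hy⟩ => ⟨y, funext fun _ => hy⟩⟩

/-! ### The full simplex -/

section Simplex

variable {E R : Type*} [LinearOrder E] [CommRing R]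

/-- The incidence sign of a vertex `v` in the face `insert v U`: minus one to the number of
elements of `U` that precede `v`. -/
def faceSign (R : Type*) [CommRing R] (v : E) (U : Finset E) : R :=
  (-1) ^ (U.filter (· < v)).card

theorem faceSign_mul_self (v : E) (U : Finset E) : faceSign R v U * faceSign R v U = 1 := by
  rw [faceSign, ← mul_pow]
  simp

theorem faceSign_insert (v : E) {u : E} {U : Finset E} (hu : u ∉ U) :
    faceSign R v (insert u U) = (if u < v then -1 else 1) * faceSign R v U := by
  unfold faceSign
  rw [Finset.filter_insert]
  split_ifs with h
  · rw [Finset.card_insert_of_notMem (by simp [hu]), pow_succ']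
  · rw [one_mul]

theorem faceSign_insert_self (v : E) (U : Finset E) :
    faceSign R v (insert v U) = faceSign R v U := by
  unfold faceSign
  rw [Finset.filter_insert, if_neg (lt_irrefl v)]

theorem map_faceSign {R' : Type*} [CommRing R'] (f : R →+* R') (v : E) (U : Finset E) :
    f (faceSign R v U) = faceSign R' v U := by
  simp [faceSign]

/-- The cone with apex `v₀`, as a map on the chains of the simplex with vertex set `E`. -/
def simplexCone (v₀ : E) (c : Finset E → R) (U : Finset E) : R :=
  if v₀ ∈ U then faceSign R v₀ U * c (U.erase v₀) else 0

variable [Fintype E]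

/-- The boundary of the chain `∑ c U • U` of the simplex with vertex set `E`. Faces of all
dimensions are treated at once, the empty face included. -/
def simplexBoundary (c : Finset E → R) (W : Finset E) : R :=
  ∑ v ∈ Wᶜ, faceSign R v W * c (insert v W)

theorem simplexBoundary_sub (c c' : Finset E → R) :
    simplexBoundary (c - c') = simplexBoundary c - simplexBoundary c' := by
  funext W
  simp [simplexBoundary, mul_sub]

theorem simplexBoundary_cone_add (v₀ : E) (c : Finset E → R) :
    simplexBoundary (simplexCone v₀ c) + simplexCone v₀ (simplexBoundary c) = c := by
  funext W
  rw [Pi.add_apply]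
  by_cases hW : v₀ ∈ W
  · obtain ⟨U, hU, rfl⟩ : ∃ U, v₀ ∉ U ∧ insert v₀ U = W :=
      ⟨W.erase v₀, Finset.notMem_erase _ _, Finset.insert_erase hW⟩
    have hcompl : Uᶜ = insert v₀ (insert v₀ U)ᶜ := by
      ext v
      by_cases hv : v = v₀ <;> simp [hv, hU]
    rw [simplexCone, if_pos hW, Finset.erase_insert hU, simplexBoundary, simplexBoundary, hcompl,
      Finset.sum_insert (by simp), faceSign_insert_self, mul_add, ← mul_assoc, faceSign_mul_self,
      one_mul, Finset.mul_sum, add_left_comm, ← Finset.sum_add_distrib,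
      Finset.sum_eq_zero, add_zero]
    intro v hv
    obtain ⟨hvv, hvU⟩ : v ≠ v₀ ∧ v ∉ U := by simpa using hv
    rw [simplexCone, if_pos (by simp), Finset.insert_comm,
      Finset.erase_insert (by simp [hU, hvv.symm]),
      faceSign_insert v hU, faceSign_insert_self, faceSign_insert v₀ hvU]
    rcases lt_or_gt_of_ne hvv with h | h
    · rw [if_neg h.not_gt, if_pos h]
      ring
    · rw [if_pos h, if_neg h.not_gt]
      ring
  · rw [simplexCone, if_neg hW, add_zero, simplexBoundary, Finset.sum_eq_single v₀, simplexCone,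
      if_pos (Finset.mem_insert_self _ _), faceSign_insert_self, Finset.erase_insert hW,
      ← mul_assoc, faceSign_mul_self, one_mul]
    · intro v _ hv
      rw [simplexCone, if_neg (by simp [hW, hv.symm]), mul_zero]
    · intro h
      exact absurd (Finset.mem_compl.2 hW) h

/-- The boundary of a boundary vanishes. It commutes with cones by `simplexBoundary_cone_add`,
and the coefficient at `W` of a chain is, up to sign, that of its cone at `insert v₀ W`, so downward
induction on the face applies. -/
theorem simplexBoundary_simplexBoundary (c : Finset E → R) :
    simplexBoundary (simplexBoundary c) = 0 := by
  suffices h : ∀ n, ∀ (c : Finset E → R) (W : Finset E), Wᶜ.card = n →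
      simplexBoundary (simplexBoundary c) W = 0 from funext fun W => h _ c W rfl
  intro n
  induction n with
  | zero =>
    intro c W hW
    rw [simplexBoundary, Finset.card_eq_zero.1 hW, Finset.sum_empty]
  | succ n ih =>
    intro c W hW
    obtain ⟨v₀, hv₀⟩ : Wᶜ.Nonempty := Finset.card_pos.1 (by omega)
    have hv₀W := Finset.mem_compl.1 hv₀
    have h1 := congrFun (simplexBoundary_cone_add v₀ (simplexBoundary c)) (insert v₀ W)
    rw [Pi.add_apply, eq_sub_of_add_eq' (simplexBoundary_cone_add v₀ c), simplexBoundary_sub,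
      Pi.sub_apply, ih _ _ (by
        rw [Finset.compl_insert, Finset.card_erase_of_mem hv₀, hW, Nat.add_sub_cancel]),
      sub_zero, add_eq_left, simplexCone, if_pos (Finset.mem_insert_self _ _),
      Finset.erase_insert hv₀W] at h1
    calc _ = faceSign R v₀ (insert v₀ W) * (faceSign R v₀ (insert v₀ W) *
            simplexBoundary (simplexBoundary c) W) := by
          rw [← mul_assoc, faceSign_mul_self, one_mul]
      _ = 0 := by rw [h1, mul_zero]

end Simplex

/-! ### The Taylor complex -/

section Taylor

variable {σ k E : Type*} [Field k] [LinearOrder E] [Fintype E]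

/-- The differential of the Taylor complex of the monomials with exponents `μ v`, in all
homological degrees at once; the basis consists of all sets of generators. -/
noncomputable def taylorMap (k : Type*) [Field k] (μ : E → σ →₀ ℕ) :
    (Finset E → MvPolynomial σ k) →ₗ[MvPolynomial σ k] (Finset E → MvPolynomial σ k) :=
  LinearMap.pi fun W => ∑ v ∈ Wᶜ,
    monomial ((insert v W).sup μ - W.sup μ) (faceSign k v W) • LinearMap.proj (insert v W)

theorem taylorMap_apply (μ : E → σ →₀ ℕ) (x : Finset E → MvPolynomial σ k) (W : Finset E) :
    taylorMap k μ x W = ∑ v ∈ Wᶜ,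
      monomial ((insert v W).sup μ - W.sup μ) (faceSign k v W) * x (insert v W) := by
  simp [taylorMap, LinearMap.sum_apply]

/-- After multiplying the coordinate at each set of generators by their lcm, the Taylor
differential becomes the boundary map of the full simplex. -/
theorem monomial_mul_taylorMap (μ : E → σ →₀ ℕ) (x : Finset E → MvPolynomial σ k)
    (W : Finset E) :
    monomial (W.sup μ) 1 * taylorMap k μ x W =
      simplexBoundary (fun U => monomial (U.sup μ) 1 * x U) W := by
  rw [taylorMap_apply, simplexBoundary, Finset.mul_sum]
  refine Finset.sum_congr rfl fun v _ => ?_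
  rw [← mul_assoc, ← mul_assoc, monomial_mul,
    add_tsub_cancel_of_le (Finset.sup_mono (Finset.subset_insert v W)), one_mul,
    ← map_faceSign (C : k →+* MvPolynomial σ k), C_mul_monomial, mul_one]

omit [LinearOrder E] [Fintype E] in
theorem eq_of_monomial_sup_mul_eq {μ : E → σ →₀ ℕ} {x y : Finset E → MvPolynomial σ k}
    (h : ∀ W, monomial (W.sup μ) 1 * x W = monomial (W.sup μ) 1 * y W) : x = y := by
  funext W
  have hne : monomial (W.sup μ) (1 : k) ≠ 0 := mt monomial_eq_zero.1 one_ne_zero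
  exact mul_left_cancel₀ hne (h W)

theorem taylorMap_taylorMap (μ : E → σ →₀ ℕ) (x : Finset E → MvPolynomial σ k) :
    taylorMap k μ (taylorMap k μ x) = 0 := by
  refine eq_of_monomial_sup_mul_eq (μ := μ) fun W => ?_
  rw [monomial_mul_taylorMap, funext (monomial_mul_taylorMap μ x),
    simplexBoundary_simplexBoundary]
  exact (mul_zero _).symm

theorem coeff_simplexBoundary (α : σ →₀ ℕ) (x : Finset E → MvPolynomial σ k) (W : Finset E) :
    coeff α (simplexBoundary x W) = simplexBoundary (fun U => coeff α (x U)) W := by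
  rw [simplexBoundary, simplexBoundary, coeff_sum]
  refine Finset.sum_congr rfl fun v _ => ?_
  rw [← map_faceSign (C : k →+* MvPolynomial σ k), coeff_C_mul]

theorem MvPolynomial.exists_coeff_eq {f : (σ →₀ ℕ) → k} (hf : f.support.Finite) :
    ∃ p : MvPolynomial σ k, ∀ m, coeff m p = f m := by
  classical
  refine ⟨∑ m ∈ hf.toFinset, monomial m (f m), fun m => ?_⟩
  rw [coeff_sum]
  simp only [coeff_monomial, Finset.sum_ite_eq']
  rw [ite_eq_left_iff]
  intro h
  by_contra h'
  exact h (hf.mem_toFinset.2 (Ne.symm h'))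

/-- The Taylor complex is exact away from the empty set. In each multidegree `α` it is the chain
complex of the full simplex on the generators that divide the monomial of exponent `α`, and a cone
over any one of them contracts it. -/
theorem exists_taylorMap_eq (μ : E → σ →₀ ℕ) {x : Finset E → MvPolynomial σ k}
    (hx : taylorMap k μ x = 0) (hx₀ : x ∅ = 0) : ∃ y, taylorMap k μ y = x := by
  classical
  set X : Finset E → MvPolynomial σ k := fun U => monomial (U.sup μ) 1 * x U with hX
  have hXle : ∀ α U, coeff α (X U) ≠ 0 → U.sup μ ≤ α := by
    intro α U h
    by_contra hle
    exact h (by rw [hX]; simp only [coeff_monomial_mul', if_neg hle])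
  have hstrand : ∀ α : σ →₀ ℕ, ∃ c : Finset E → k,
      (simplexBoundary c = fun U => coeff α (X U)) ∧ (∀ U, c U ≠ 0 → U.sup μ ≤ α) ∧
        ∀ U, c U ≠ 0 → ∃ v ∈ U, coeff α (X (U.erase v)) ≠ 0 := by
    intro α
    by_cases hα : ∃ W, coeff α (X W) ≠ 0
    · obtain ⟨W, hW⟩ := hα
      obtain ⟨v₀, hv₀⟩ : W.Nonempty := by
        rw [Finset.nonempty_iff_ne_empty]
        rintro rfl
        simp [hX, hx₀] at hW
      have hcone : ∀ U, simplexCone v₀ (fun U => coeff α (X U)) U ≠ 0 →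
          v₀ ∈ U ∧ coeff α (X (U.erase v₀)) ≠ 0 := by
        intro U hU
        rw [simplexCone] at hU
        split_ifs at hU with h
        · exact ⟨h, right_ne_zero_of_mul hU⟩
        · exact absurd rfl hU
      refine ⟨simplexCone v₀ fun U => coeff α (X U), ?_, fun U hU => ?_,
        fun U hU => ⟨v₀, hcone U hU⟩⟩
      · have h0 : simplexBoundary (fun U => coeff α (X U)) = 0 := by
          funext U
          rw [← coeff_simplexBoundary, hX, ← monomial_mul_taylorMap, hx]
          simp
        have h1 := simplexBoundary_cone_add v₀ fun U => coeff α (X U)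
        have h2 : simplexCone v₀ (0 : Finset E → k) = 0 := by
          funext U
          simp [simplexCone]
        rwa [h0, h2, add_zero] at h1
      · obtain ⟨hvU, hU'⟩ := hcone U hU
        rw [← Finset.insert_erase hvU, Finset.sup_insert]
        exact sup_le ((Finset.le_sup hv₀).trans (hXle _ _ hW)) (hXle _ _ hU')
    · push Not at hα
      exact ⟨0, by funext U; simp [simplexBoundary, hα], by simp, by simp⟩
  choose c hc hcle hcsupp using hstrand
  have hfin : ∀ U, (Function.support fun β => c (β + U.sup μ) U).Finite := by
    intro U
    refine Set.Finite.subset (Set.Finite.preimage (add_left_injective (U.sup μ)).injOn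
      (U.biUnion fun v => (X (U.erase v)).support).finite_toSet) fun β hβ => ?_
    obtain ⟨v, hv, hne⟩ := hcsupp _ _ hβ
    simp only [Set.mem_preimage, Finset.mem_coe, Finset.mem_biUnion, mem_support_iff]
    exact ⟨v, hv, hne⟩
  choose y hy using fun U => exists_coeff_eq (hfin U)
  refine ⟨y, eq_of_monomial_sup_mul_eq (μ := μ) fun W => ?_⟩
  rw [monomial_mul_taylorMap]
  ext α
  have hcy : (fun U => coeff α (monomial (U.sup μ) 1 * y U)) = c α := by
    funext U
    rw [coeff_monomial_mul']
    split_ifs with h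
    · rw [one_mul, hy, tsub_add_cancel_of_le h]
    · by_contra hne
      exact h (hcle α U (Ne.symm hne))
  rw [coeff_simplexBoundary, hcy, hc]

/-- The Taylor differential between the spans of the sets of `n + 1` and of `n` generators. -/
noncomputable def taylorDifferential (k : Type*) [Field k] (μ : E → σ →₀ ℕ) (n : ℕ) :
    ({W : Finset E // W.card = n + 1} → MvPolynomial σ k) →ₗ[MvPolynomial σ k]
      ({W : Finset E // W.card = n} → MvPolynomial σ k) :=
  LinearMap.funLeft _ _ Subtype.val ∘ₗ taylorMap k μ ∘ₗ
    Function.ExtendByZero.linearMap _ Subtype.val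

omit [LinearOrder E] [Fintype E] in
theorem extend_val_apply {n : ℕ} (x : {W : Finset E // W.card = n} → MvPolynomial σ k)
    (U : Finset E) :
    Function.ExtendByZero.linearMap (MvPolynomial σ k) Subtype.val x U =
      if h : U.card = n then x ⟨U, h⟩ else 0 := by
  rw [Function.ExtendByZero.linearMap_apply]
  split_ifs with h
  · exact Subtype.val_injective.extend_apply x 0 ⟨U, h⟩
  · exact Function.extend_apply' _ _ _ (by rintro ⟨V, rfl⟩; exact h V.2)

theorem extend_taylorDifferential (μ : E → σ →₀ ℕ) (n : ℕ)
    (x : {W : Finset E // W.card = n + 1} → MvPolynomial σ k) :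
    Function.ExtendByZero.linearMap (MvPolynomial σ k) Subtype.val (taylorDifferential k μ n x) =
      taylorMap k μ (Function.ExtendByZero.linearMap _ Subtype.val x) := by
  funext W
  rw [extend_val_apply]
  split_ifs with h
  · rfl
  · rw [taylorMap_apply]
    refine (Finset.sum_eq_zero fun v hv => ?_).symm
    rw [extend_val_apply, dif_neg, mul_zero]
    rw [Finset.card_insert_of_notMem (Finset.mem_compl.1 hv)]
    omega

theorem exact_taylorDifferential (μ : E → σ →₀ ℕ) (n : ℕ) :
    Function.Exact (taylorDifferential k μ (n + 1)) (taylorDifferential k μ n) := by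
  intro x
  constructor
  · intro hx
    obtain ⟨y, hy⟩ := exists_taylorMap_eq μ
      (x := Function.ExtendByZero.linearMap _ Subtype.val x)
      (by rw [← extend_taylorDifferential, hx, map_zero])
      (by rw [extend_val_apply, dif_neg (by simp)])
    refine ⟨fun U => y U.1, funext fun W => ?_⟩
    have h := congrFun hy W.1
    rw [extend_val_apply, dif_pos W.2] at h
    refine Eq.trans ?_ h
    change taylorMap k μ _ W.1 = _
    rw [taylorMap_apply, taylorMap_apply]
    refine Finset.sum_congr rfl fun v hv => ?_
    rw [extend_val_apply, dif_pos]
    rw [Finset.card_insert_of_notMem (Finset.mem_compl.1 hv), W.2]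
  · rintro ⟨y, rfl⟩
    funext W
    change taylorMap k μ _ W.1 = 0
    rw [extend_taylorDifferential, taylorMap_taylorMap, Pi.zero_apply]

theorem taylorDifferential_single_apply (μ : E → σ →₀ ℕ) (n : ℕ)
    (U : {W : Finset E // W.card = n + 1}) (W : {W : Finset E // W.card = n}) :
    taylorDifferential k μ n (Pi.single U 1) W = ∑ v ∈ W.1ᶜ,
      if insert v W.1 = U.1 then
        monomial (U.1.sup μ - W.1.sup μ) (faceSign k v W.1) else 0 := by
  change taylorMap k μ _ W.1 = _
  rw [taylorMap_apply]
  refine Finset.sum_congr rfl fun v hv => ?_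
  rw [extend_val_apply, dif_pos (by
    rw [Finset.card_insert_of_notMem (Finset.mem_compl.1 hv), W.2]), Pi.single_apply]
  simp only [Subtype.ext_iff]
  split_ifs with h
  · rw [h, mul_one]
  · rw [mul_zero]

/-- The Taylor complex of the monomials with exponents `μ v`, the augmentation included. -/
noncomputable def taylorComplex (k : Type*) [Field k] (μ : E → σ →₀ ℕ) :
    GradedExactComplex σ k where
  ι n := {W : Finset E // W.card = n}
  deg _ W := (W.1.sup μ).degree
  d := taylorDifferential k μ
  d_graded n U W := by
    rw [taylorDifferential_single_apply]
    refine IsHomogeneousOfIntDegree.sum fun v _ => ?_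
    split_ifs with h
    · have hle : W.1.sup μ ≤ U.1.sup μ := Finset.sup_mono (h ▸ Finset.subset_insert v W.1)
      have := IsHomogeneousOfIntDegree.monomial (U.1.sup μ - W.1.sup μ) (faceSign k v W.1)
      rwa [← eq_sub_of_add_eq (a := ((U.1.sup μ - W.1.sup μ).degree : ℤ))]
      rw [← Nat.cast_add, ← map_add, tsub_add_cancel_of_le hle]
    · exact IsHomogeneousOfIntDegree.zero _
  exact := exact_taylorDifferential μ

theorem isMinimal_taylorComplex {μ : E → σ →₀ ℕ}
    (hμ : ∀ v (W : Finset E), v ∉ W → ¬ μ v ≤ W.sup μ) : (taylorComplex k μ).IsMinimal := by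
  classical
  intro n U W
  change constantCoeff (taylorDifferential k μ (n + 1) (Pi.single U 1) W) = 0
  refine (congrArg constantCoeff (taylorDifferential_single_apply μ (n + 1) U W)).trans ?_
  rw [map_sum]
  refine Finset.sum_eq_zero fun v hv => ?_
  split_ifs with h
  · rw [constantCoeff_monomial, if_neg]
    rw [tsub_eq_zero_iff_le, ← h, Finset.sup_insert]
    exact fun hle => hμ v W.1 (Finset.mem_compl.1 hv) (le_sup_left.trans hle)
  · exact map_zero _

theorem resolves_taylorComplex (μ : E → σ →₀ ℕ) :
    (taylorComplex k μ).Resolves (Ideal.span (Set.range fun v => monomial (μ v) 1)) := by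
  refine ⟨⟨∅, rfl⟩, fun W => Subtype.ext (Finset.card_eq_zero.1 W.2), ?_, fun x => ?_⟩
  · change (((∅ : Finset E).sup μ).degree : ℤ) = 0
    rw [Finset.sup_empty, bot_eq_zero, map_zero, Nat.cast_zero]
  have hd : ∀ y : {W : Finset E // W.card = 0 + 1} → MvPolynomial σ k,
      taylorDifferential k μ 0 y ⟨∅, rfl⟩ =
        ∑ v, y ⟨{v}, Finset.card_singleton v⟩ * monomial (μ v) 1 := by
    intro y
    change taylorMap k μ _ ∅ = _
    rw [taylorMap_apply, Finset.compl_empty]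
    refine Finset.sum_congr rfl fun v _ => ?_
    rw [extend_val_apply, dif_pos (by simp), mul_comm]
    simp [faceSign, bot_eq_zero]
  rw [Ideal.mem_span_range_iff_exists_fun]
  constructor
  · rintro ⟨y, rfl⟩
    exact ⟨_, (hd y).symm⟩
  · rintro ⟨c, hc⟩
    refine ⟨fun U => ∑ v ∈ U.1, c v, funext fun W => ?_⟩
    obtain rfl : W = ⟨∅, rfl⟩ := Subtype.ext (Finset.card_eq_zero.1 W.2)
    rw [← hc]
    refine (hd _).trans ?_
    simp

end Taylor

/-! ### Taylor complexes of edge ideals -/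

section SqfreeExponent

variable {σ : Type*} [DecidableEq σ]

theorem sqfreeExponent_apply (F : Finset σ) (x : σ) :
    sqfreeExponent F x = if x ∈ F then 1 else 0 := by
  simp [sqfreeExponent, Finsupp.finsetSum_apply, Finsupp.single_apply]

omit [DecidableEq σ] in
theorem degree_sqfreeExponent (F : Finset σ) : (sqfreeExponent F).degree = F.card := by
  simp [sqfreeExponent, map_sum]

theorem sqfreeExponent_le_iff {F F' : Finset σ} :
    sqfreeExponent F ≤ sqfreeExponent F' ↔ F ⊆ F' := by
  refine forall_congr' fun x => ?_
  rw [sqfreeExponent_apply, sqfreeExponent_apply]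
  by_cases h : x ∈ F <;> by_cases h' : x ∈ F' <;> simp [h, h']

theorem sup_sqfreeExponent {ι : Type*} (W : Finset ι) (F : ι → Finset σ) :
    (W.sup fun i => sqfreeExponent (F i)) = sqfreeExponent (W.biUnion F) := by
  classical
  induction W using Finset.induction_on with
  | empty => simp [sqfreeExponent, bot_eq_zero]
  | insert i W hi ih =>
    ext x
    rw [Finset.sup_insert, ih, Finset.biUnion_insert, Finsupp.sup_apply]
    simp only [sqfreeExponent_apply, Finset.mem_union]
    by_cases h : x ∈ F i <;> by_cases h' : x ∈ W.biUnion F <;> simp only [h, h'] <;> rfl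

end SqfreeExponent

namespace Clutter

variable {σ : Type*}

/-- The Taylor complex of the edge ideal of `G`, for an enumeration of the edges. -/
noncomputable def taylorComplex (k : Type*) [Field k] (G : Clutter σ) :
    GradedExactComplex.{_, _, 0} σ k :=
  _root_.taylorComplex k fun i : Fin G.edges.card => sqfreeExponent (G.edges.equivFin.symm i).1

theorem resolves_taylorComplex (k : Type*) [Field k] (G : Clutter σ) :
    (G.taylorComplex k).Resolves (G.edgeIdeal k) := by
  have h : G.edgeIdeal k = Ideal.span (Set.range fun i : Fin G.edges.card =>
      monomial (sqfreeExponent (G.edges.equivFin.symm i).1) (1 : k)) := by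
    refine congrArg Ideal.span (Set.ext fun p => ?_)
    constructor
    · rintro ⟨F, hF, rfl⟩
      exact ⟨G.edges.equivFin ⟨F, hF⟩, by simp⟩
    · rintro ⟨i, rfl⟩
      exact ⟨_, (G.edges.equivFin.symm i).2, rfl⟩
  rw [h]
  exact _root_.resolves_taylorComplex _

theorem rankInDegree_taylorComplex (k : Type*) [Field k] (G : Clutter σ) (i : ℕ) (a : ℤ) :
    (G.taylorComplex k).rankInDegree (i + 1) a = G.taylorBetti i a := by
  classical
  let f : Fin G.edges.card ↪ Finset σ :=
    G.edges.equivFin.symm.toEmbedding.trans (Function.Embedding.subtype _)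
  have hf : Finset.univ.map f = G.edges := by
    ext F
    simp only [Finset.mem_map, Finset.mem_univ, true_and]
    constructor
    · rintro ⟨i, rfl⟩
      exact (G.edges.equivFin.symm i).2
    · intro hF
      exact ⟨G.edges.equivFin ⟨F, hF⟩, by simp [f]⟩
  have hsup : ∀ W : Finset (Fin G.edges.card), (W.map f).sup sqfreeExponent =
      W.sup fun i => sqfreeExponent (G.edges.equivFin.symm i).1 := fun W => Finset.sup_map _ _ _
  rw [GradedExactComplex.rankInDegree, Fintype.card, taylorBetti]
  refine Finset.card_bij (fun W _ => W.1.1.map f) ?_ ?_ ?_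
  · rintro ⟨⟨W, hW⟩, hdeg⟩ -
    rw [Finset.mem_filter, Finset.mem_powersetCard, hsup, Finset.card_map]
    refine ⟨⟨?_, hW⟩, hdeg⟩
    conv_rhs => rw [← hf]
    exact Finset.map_subset_map.2 (Finset.subset_univ _)
  · intro W _ V _ h
    exact Subtype.ext (Subtype.ext (Finset.map_injective f h))
  · intro V hV
    rw [Finset.mem_filter, Finset.mem_powersetCard] at hV
    obtain ⟨⟨hsub, hcard⟩, hdeg⟩ := hV
    rw [← hf, Finset.subset_map_iff] at hsub
    obtain ⟨W, -, rfl⟩ := hsub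
    rw [hsup] at hdeg
    exact ⟨⟨⟨W, by rwa [Finset.card_map] at hcard⟩, hdeg⟩, Finset.mem_univ _, rfl⟩

/-- The Taylor resolution bounds the graded Betti numbers of the edge ideal. -/
theorem betti_le_taylorBetti {k : Type*} [Field k] (G : Clutter σ)
    (R : MinimalGradedFreeResolution (G.edgeIdeal k)) (i : ℕ) (a : ℤ) :
    R.betti i a ≤ G.taylorBetti i a := by
  rw [← R.rankInDegree_augmented, ← G.rankInDegree_taylorComplex k]
  exact R.isMinimal_augmented.rankInDegree_le_of_resolves R.resolves_augmented
    (G.resolves_taylorComplex k) i a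

/-- If every edge has a vertex that lies in no other edge, the Taylor resolution is minimal. -/
theorem isMinimal_taylorComplex (k : Type*) [Field k] (G : Clutter σ)
    (hG : ∀ F ∈ G.edges, ∃ v ∈ F, ∀ F' ∈ G.edges, v ∈ F' → F' = F) :
    (G.taylorComplex k).IsMinimal := by
  classical
  refine _root_.isMinimal_taylorComplex fun i W hi hle => ?_
  rw [sup_sqfreeExponent, sqfreeExponent_le_iff] at hle
  obtain ⟨v, hv, huniq⟩ := hG _ (G.edges.equivFin.symm i).2
  obtain ⟨j, hj, hvj⟩ := Finset.mem_biUnion.1 (hle hv)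
  have hji := huniq _ (G.edges.equivFin.symm j).2 hvj
  rw [Subtype.coe_inj, EmbeddingLike.apply_eq_iff_eq] at hji
  exact hi (hji ▸ hj)

/-- The Betti numbers agree with those of the Taylor resolution when the latter is minimal. -/
theorem betti_eq_taylorBetti {k : Type*} [Field k] (G : Clutter σ)
    (hG : (G.taylorComplex k).IsMinimal)
    (R : MinimalGradedFreeResolution (G.edgeIdeal k)) (i : ℕ) (a : ℤ) :
    R.betti i a = G.taylorBetti i a := by
  refine (G.betti_le_taylorBetti R i a).antisymm ?_
  rw [← R.rankInDegree_augmented, ← G.rankInDegree_taylorComplex k]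
  exact hG.rankInDegree_le_of_resolves (G.resolves_taylorComplex k) R.resolves_augmented i a

end Clutter

/-! ### Triples of vertices spanning exactly one edge -/

theorem six_mul_choose_three (n : ℕ) :
    6 * (n.choose 3 : ℤ) = (n : ℤ) * ((n : ℤ) - 1) * ((n : ℤ) - 2) := by
  have h2 : ∀ n : ℕ, 2 * (n.choose 2 : ℤ) = (n : ℤ) * ((n : ℤ) - 1) := by
    intro n
    induction n with
    | zero => simp
    | succ n ih =>
      rw [Nat.choose_succ_succ' n 1, Nat.choose_one_right]
      push_cast
      linear_combination ih
  induction n with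
  | zero => simp
  | succ n ih =>
    rw [Nat.choose_succ_succ' n 2]
    push_cast
    linear_combination ih + 3 * h2 n

/-- The two parts of a nearly even `2`-partition in terms of the smaller one. -/
theorem IsNearlyEvenPartition.two_mul_choose {t t₁ t₂ : ℕ}
    (h : IsNearlyEvenPartition t ![t₁, t₂]) : ∃ m : ℕ,
      (t = 2 * m ∧
        2 * ((t.choose 3 : ℤ) - t₁.choose 3 - t₂.choose 3) = 2 * m * (m * (m - 1))) ∨
      (t = 2 * m + 1 ∧
        2 * ((t.choose 3 : ℤ) - t₁.choose 3 - t₂.choose 3) = (2 * m + 1) * m ^ 2 - m) := by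
  obtain ⟨hsum, habs⟩ := h
  have hsum : t₁ + t₂ = t := by simpa using hsum
  have habs : |(t₁ : ℤ) - t₂| ≤ 1 := habs 0 1 (by simp)
  rw [abs_le] at habs
  have h0 := six_mul_choose_three t
  have h1 := six_mul_choose_three t₁
  have h2 := six_mul_choose_three t₂
  obtain h | h | h : t₁ = t₂ ∨ t₁ = t₂ + 1 ∨ t₂ = t₁ + 1 := by omega
  · obtain rfl : t = 2 * t₂ := by omega
    subst h
    refine ⟨t₁, Or.inl ⟨rfl, ?_⟩⟩
    push_cast at h0
    linarith
  · obtain rfl : t = 2 * t₂ + 1 := by omega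
    subst h
    refine ⟨t₂, Or.inr ⟨rfl, ?_⟩⟩
    push_cast at h0 h1
    linarith
  · obtain rfl : t = 2 * t₁ + 1 := by omega
    subst h
    refine ⟨t₁, Or.inr ⟨rfl, ?_⟩⟩
    push_cast at h0 h2
    linarith

namespace SimpleGraph

variable {V : Type*} [Fintype V] [DecidableEq V] (G : SimpleGraph V) [DecidableRel G.Adj]

/-- The number of pairs `(y, z)` such that `x y` is the only edge among three distinct vertices
`x`, `y`, `z`. -/
def oneEdgeCount (x : V) : ℕ :=
  (Finset.univ.filter fun q : V × V =>
    (G.Adj x q.1 ∧ Gᶜ.Adj x q.2) ∧ Gᶜ.Adj q.1 q.2).card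

/-- The number of induced paths `x y z` that start at `x`. -/
def pathCount (x : V) : ℕ :=
  (Finset.univ.filter fun q : V × V =>
    (G.Adj x q.1 ∧ Gᶜ.Adj x q.2) ∧ ¬ Gᶜ.Adj q.1 q.2).card

theorem oneEdgeCount_add_pathCount (x : V) :
    (G.oneEdgeCount x + G.pathCount x : ℤ) =
      G.degree x * (Fintype.card V - 1 - G.degree x) := by
  have h : Finset.univ.filter (fun q : V × V => G.Adj x q.1 ∧ Gᶜ.Adj x q.2) =
      G.neighborFinset x ×ˢ Gᶜ.neighborFinset x := by
    ext q
    simp [mem_neighborFinset]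
  have h2 := G.degree_compl x
  have h3 := G.degree_lt_card_verts x
  have h4 := Finset.card_filter_add_card_filter_not
    (s := Finset.univ.filter fun q : V × V => G.Adj x q.1 ∧ Gᶜ.Adj x q.2)
    fun q => Gᶜ.Adj q.1 q.2
  rw [Finset.filter_filter, Finset.filter_filter] at h4
  rw [← Nat.cast_add, oneEdgeCount, pathCount, h4, h, Finset.card_product,
    card_neighborFinset_eq_degree, card_neighborFinset_eq_degree, h2, Nat.cast_mul,
    Nat.cast_sub (by omega), Nat.cast_sub (by omega), Nat.cast_one]

/-- If no induced path starts at `v`, the closed neighbourhood of `v` is a component, so the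
neighbours of a vertex outside it are also outside it. -/
theorem degree_add_one_le_of_pathCount_eq_zero {v u : V} (hv : G.pathCount v = 0)
    (hu : Gᶜ.Adj v u) : G.degree u + 1 ≤ Gᶜ.degree v := by
  have hsub : insert u (G.neighborFinset u) ⊆ Gᶜ.neighborFinset v := by
    intro w hw
    rw [Finset.mem_insert, mem_neighborFinset] at hw
    rw [mem_neighborFinset]
    rcases hw with rfl | hw
    · exact hu
    · rw [compl_adj] at hu ⊢
      refine ⟨?_, fun hvw => ?_⟩
      · rintro rfl
        exact hu.2 hw.symm
      · have hmem : (w, u) ∈ Finset.univ.filter (fun q : V × V =>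
            (G.Adj v q.1 ∧ Gᶜ.Adj v q.2) ∧ ¬ Gᶜ.Adj q.1 q.2) := by
          simp only [Finset.mem_filter, Finset.mem_univ, true_and, compl_adj]
          exact ⟨⟨hvw, hu⟩, fun h => h.2 hw.symm⟩
        rw [pathCount, Finset.card_eq_zero] at hv
        exact absurd (hv ▸ hmem) (Finset.notMem_empty _)
  have := Finset.card_le_card hsub
  rwa [Finset.card_insert_of_notMem (by simp), card_neighborFinset_eq_degree,
    card_neighborFinset_eq_degree] at this

theorem sum_oneEdgeCount_le_of_card_eq_two_mul {m : ℕ} (hV : Fintype.card V = 2 * m) :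
    (∑ x, G.oneEdgeCount x : ℤ) ≤ 2 * m * (m * (m - 1)) := by
  have h : ∀ x ∈ Finset.univ, (G.oneEdgeCount x : ℤ) ≤ m * (m - 1) := by
    intro x _
    have h1 := G.oneEdgeCount_add_pathCount x
    rw [hV] at h1
    push_cast at h1
    -- `(d - m) (d - m + 1)` is a product of consecutive integers
    have h2 : 0 ≤ ((G.degree x : ℤ) - m) * (G.degree x - m + 1) := by
      rcases le_or_gt (m : ℤ) (G.degree x) with h | h
      · exact mul_nonneg (by omega) (by omega)
      · exact mul_nonneg_of_nonpos_of_nonpos (by omega) (by omega)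
    have h3 : (0 : ℤ) ≤ G.pathCount x := Nat.cast_nonneg _
    linarith
  refine (Finset.sum_le_card_nsmul _ _ _ h).trans (le_of_eq ?_)
  rw [Finset.card_univ, hV, nsmul_eq_mul]
  push_cast
  ring

/-- For an odd number `2m + 1` of vertices, the degree count alone is too weak by `m / 2` triples;
it is attained only if all degrees are `m` and there are no induced paths. A vertex of degree `m`
where no induced path starts has as closed neighbourhood a component, and the `m` vertices outside
have smaller degree; without such a vertex, every vertex contributes a loss. -/
theorem sum_oneEdgeCount_le_of_card_eq_two_mul_add_one {m : ℕ}
    (hV : Fintype.card V = 2 * m + 1) :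
    (∑ x, G.oneEdgeCount x : ℤ) ≤ (2 * m + 1) * m ^ 2 - m := by
  have hx : ∀ x, (G.oneEdgeCount x : ℤ) + G.pathCount x + (G.degree x - m) ^ 2 = m ^ 2 := by
    intro x
    have h1 := G.oneEdgeCount_add_pathCount x
    rw [hV] at h1
    push_cast at h1
    linarith
  suffices h : ∃ B : Finset V, m ≤ B.card ∧ ∀ x ∈ B, (G.oneEdgeCount x : ℤ) ≤ m ^ 2 - 1 by
    obtain ⟨B, hBcard, hB⟩ := h
    have h1 : (m : ℤ) ≤ ∑ x, ((m : ℤ) ^ 2 - G.oneEdgeCount x) :=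
      calc (m : ℤ) ≤ B.card := by exact_mod_cast hBcard
        _ = ∑ x ∈ B, 1 := by simp
        _ ≤ ∑ x ∈ B, ((m : ℤ) ^ 2 - G.oneEdgeCount x) :=
          Finset.sum_le_sum fun x h => by linarith [hB x h]
        _ ≤ _ := Finset.sum_le_sum_of_subset_of_nonneg (Finset.subset_univ _) fun x _ _ => by
          have h3 : (0 : ℤ) ≤ G.pathCount x := Nat.cast_nonneg _
          linarith [hx x, sq_nonneg ((G.degree x : ℤ) - m)]
    rw [Finset.sum_sub_distrib, Finset.sum_const, Finset.card_univ, hV, nsmul_eq_mul] at h1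
    push_cast at h1
    linarith
  by_cases hv : ∃ v, G.degree v = m ∧ G.pathCount v = 0
  · obtain ⟨v, hvdeg, hvpath⟩ := hv
    have hcompl : Gᶜ.degree v = m := by
      rw [degree_compl]
      omega
    refine ⟨Gᶜ.neighborFinset v, by rw [card_neighborFinset_eq_degree, hcompl], fun u hu => ?_⟩
    rw [mem_neighborFinset] at hu
    have hle := G.degree_add_one_le_of_pathCount_eq_zero hvpath hu
    rw [hcompl] at hle
    have h1 : (0 : ℤ) ≤ G.pathCount u := Nat.cast_nonneg _
    have h2 : (1 : ℤ) ≤ (G.degree u - m) ^ 2 := by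
      have : (G.degree u : ℤ) - m ≤ -1 := by omega
      nlinarith
    linarith [hx u]
  · refine ⟨Finset.univ, by rw [Finset.card_univ]; omega, fun x _ => ?_⟩
    push Not at hv
    by_cases hdeg : G.degree x = m
    · have h1 : (1 : ℤ) ≤ G.pathCount x := by
        exact_mod_cast Nat.one_le_iff_ne_zero.2 (hv x hdeg)
      linarith [hx x, sq_nonneg ((G.degree x : ℤ) - m)]
    · have h1 : (0 : ℤ) ≤ G.pathCount x := Nat.cast_nonneg _
      have h2 : (1 : ℤ) ≤ (G.degree x - m) ^ 2 := by
        have h3 : (0 : ℤ) < (G.degree x - m) ^ 2 :=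
          sq_pos_of_ne_zero (sub_ne_zero.2 (by exact_mod_cast hdeg))
        omega
      linarith [hx x]

theorem sum_oneEdgeCount_le {t₁ t₂ : ℕ}
    (h : IsNearlyEvenPartition (Fintype.card V) ![t₁, t₂]) :
    (∑ x, G.oneEdgeCount x : ℤ) ≤
      2 * (((Fintype.card V).choose 3 : ℤ) - t₁.choose 3 - t₂.choose 3) := by
  obtain ⟨m, ⟨hV, hm⟩ | ⟨hV, hm⟩⟩ := h.two_mul_choose
  · rw [hm]
    exact G.sum_oneEdgeCount_le_of_card_eq_two_mul hV
  · rw [hm]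
    exact G.sum_oneEdgeCount_le_of_card_eq_two_mul_add_one hV

end SimpleGraph

/-! ### Triples of edges with an lcm of degree `3 d - 1` -/

/-- By inclusion and exclusion, three `d`-element sets with a union of `3 d - 1` elements have
exactly one intersecting pair. -/
theorem Finset.exists_disjoint_of_card_union {α : Type*} [DecidableEq α] {A B C : Finset α}
    {d : ℕ} (hA : A.card = d) (hB : B.card = d) (hC : C.card = d)
    (h : (((A ∪ B) ∪ C).card : ℤ) = 3 * (d : ℤ) - 1) :
    (¬ Disjoint A B ∧ Disjoint A C ∧ Disjoint B C) ∨
      (¬ Disjoint A C ∧ Disjoint A B ∧ Disjoint C B) ∨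
      (¬ Disjoint B C ∧ Disjoint B A ∧ Disjoint C A) := by
  have h1 := Finset.card_union_add_card_inter A B
  have h2 := Finset.card_union_add_card_inter (A ∪ B) C
  have h3 : (A ∩ B).card + ((A ∪ B) ∩ C).card = 1 := by omega
  rcases Nat.eq_zero_or_pos (A ∩ B).card with h0 | h0
  · have hAB : Disjoint A B :=
      Finset.disjoint_iff_inter_eq_empty.2 (Finset.card_eq_zero.1 h0)
    obtain ⟨p, hp⟩ := Finset.card_eq_one.1 (show ((A ∪ B) ∩ C).card = 1 by omega)
    have hmem : ∀ q, q ∈ (A ∪ B) ∩ C ↔ q = p := fun q => by rw [hp, Finset.mem_singleton]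
    simp only [Finset.mem_inter, Finset.mem_union] at hmem
    obtain ⟨hpAB, hpC⟩ := (hmem p).2 rfl
    rcases hpAB with hpA | hpB
    · refine Or.inr (Or.inl ⟨Finset.not_disjoint_iff.2 ⟨p, hpA, hpC⟩, hAB, ?_⟩)
      refine Finset.disjoint_left.2 fun q hqC hqB => ?_
      rw [(hmem q).1 ⟨Or.inr hqB, hqC⟩] at hqB
      exact Finset.disjoint_left.1 hAB hpA hqB
    · refine Or.inr (Or.inr ⟨Finset.not_disjoint_iff.2 ⟨p, hpB, hpC⟩, hAB.symm, ?_⟩)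
      refine Finset.disjoint_left.2 fun q hqC hqA => ?_
      rw [(hmem q).1 ⟨Or.inl hqA, hqC⟩] at hqA
      exact Finset.disjoint_left.1 hAB hqA hpB
  · refine Or.inl ⟨fun hd => ?_, ?_⟩
    · rw [Finset.disjoint_iff_inter_eq_empty.1 hd, Finset.card_empty] at h0
      exact lt_irrefl _ h0
    · rw [← Finset.disjoint_union_left, Finset.disjoint_iff_inter_eq_empty]
      exact Finset.card_eq_zero.1 (by omega)

namespace Clutter

variable {σ : Type*} [DecidableEq σ]

/-- The graph on the edges of `H` in which two edges are adjacent when they intersect. -/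
def intersectionGraph (H : Clutter σ) : SimpleGraph H.edges where
  Adj A B := A ≠ B ∧ ¬ Disjoint A.1 B.1
  symm := ⟨fun _ _ h => ⟨h.1.symm, fun h' => h.2 h'.symm⟩⟩
  loopless := ⟨fun _ h => h.1 rfl⟩

instance (H : Clutter σ) : DecidableRel H.intersectionGraph.Adj :=
  fun A B => inferInstanceAs (Decidable (A ≠ B ∧ ¬ Disjoint A.1 B.1))

/-- The triples counted by `β^T_{2,3d-1}` span exactly one edge of the intersection graph, which
can be oriented in two ways. -/
theorem taylorBetti_two_mul_two_le {H : Clutter σ} {d : ℕ} (hd : H.IsPureOfDegree d) :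
    H.taylorBetti 2 (3 * (d : ℤ) - 1) * 2 ≤ ∑ x, H.intersectionGraph.oneEdgeCount x := by
  set G := H.intersectionGraph with hG
  set T := (Finset.univ : Finset (H.edges × H.edges × H.edges)).filter fun p =>
    (G.Adj p.1 p.2.1 ∧ Gᶜ.Adj p.1 p.2.2) ∧ Gᶜ.Adj p.2.1 p.2.2 with hT
  have hTcard : T.card = ∑ x, G.oneEdgeCount x := by
    simp only [hT, SimpleGraph.oneEdgeCount, Finset.card_filter, Fintype.sum_prod_type]
  rw [← hTcard, taylorBetti, ← mul_one T.card]
  refine Finset.card_mul_le_card_mul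
    (fun (W : Finset (Finset σ)) (p : H.edges × H.edges × H.edges) =>
      W = {p.1.1, p.2.1.1, p.2.2.1}) ?_ ?_
  · intro W hW
    rw [Finset.mem_filter, Finset.mem_powersetCard] at hW
    obtain ⟨⟨hsub, hcard⟩, hdeg⟩ := hW
    have key : ∃ A B C : Finset σ, A ≠ B ∧ A ≠ C ∧ B ≠ C ∧ W = {A, B, C} ∧
        ¬ Disjoint A B ∧ Disjoint A C ∧ Disjoint B C := by
      obtain ⟨A, B, C, hAB, hAC, hBC, rfl⟩ := Finset.card_eq_three.1 hcard
      have hsup := sup_sqfreeExponent {A, B, C} id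
      simp only [id_eq] at hsup
      rw [hsup, degree_sqfreeExponent] at hdeg
      simp only [Finset.biUnion_insert, Finset.singleton_biUnion, id_eq, ← Finset.union_assoc]
        at hdeg
      rcases Finset.exists_disjoint_of_card_union (hd A (hsub (by simp))) (hd B (hsub (by simp)))
        (hd C (hsub (by simp))) hdeg with h | h | h
      · exact ⟨A, B, C, hAB, hAC, hBC, rfl, h⟩
      · exact ⟨A, C, B, hAC, hAB, hBC.symm, by rw [Finset.pair_comm], h⟩
      · exact ⟨B, C, A, hBC, hAB.symm, hAC.symm,
          by rw [Finset.insert_comm, Finset.pair_comm A C], h⟩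
    obtain ⟨A, B, C, hAB, hAC, hBC, rfl, hdAB, hdAC, hdBC⟩ := key
    let a : H.edges := ⟨A, hsub (by simp)⟩
    let b : H.edges := ⟨B, hsub (by simp)⟩
    let c : H.edges := ⟨C, hsub (by simp)⟩
    have hab : G.Adj a b := ⟨fun h => hAB (congrArg Subtype.val h), hdAB⟩
    have hac : Gᶜ.Adj a c := ⟨fun h => hAC (congrArg Subtype.val h), fun h => h.2 hdAC⟩
    have hbc : Gᶜ.Adj b c := ⟨fun h => hBC (congrArg Subtype.val h), fun h => h.2 hdBC⟩
    have hpair : ({(a, b, c), (b, a, c)} : Finset _).card = 2 :=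
      Finset.card_pair fun h => hab.ne (congrArg Prod.fst h)
    rw [← hpair]
    refine Finset.card_le_card fun p hp => ?_
    rw [Finset.mem_insert, Finset.mem_singleton] at hp
    rw [Finset.mem_bipartiteAbove, hT, Finset.mem_filter]
    rcases hp with rfl | rfl
    · exact ⟨⟨Finset.mem_univ _, ⟨hab, hac⟩, hbc⟩, rfl⟩
    · exact ⟨⟨Finset.mem_univ _, ⟨hab.symm, hbc⟩, hac⟩, Finset.insert_comm _ _ _⟩
  · intro p _
    refine Finset.card_le_one.2 fun W hW W' hW' => ?_
    rw [Finset.mem_bipartiteBelow] at hW hW'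
    exact hW.2.trans hW'.2.symm

omit [DecidableEq σ] in
theorem taylorBetti_two_le {H : Clutter σ} {d t₁ t₂ : ℕ} (hd : H.IsPureOfDegree d)
    (hpart : IsNearlyEvenPartition H.edges.card ![t₁, t₂]) :
    (H.taylorBetti 2 (3 * (d : ℤ) - 1) : ℤ) ≤
      (H.edges.card.choose 3 : ℤ) - t₁.choose 3 - t₂.choose 3 := by
  classical
  rw [← Fintype.card_coe] at hpart ⊢
  have h1 := H.intersectionGraph.sum_oneEdgeCount_le hpart
  have h2 : ((H.taylorBetti 2 (3 * (d : ℤ) - 1) * 2 : ℕ) : ℤ) ≤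
      ((∑ x, H.intersectionGraph.oneEdgeCount x : ℕ) : ℤ) :=
    Nat.cast_le.2 (taylorBetti_two_mul_two_le hd)
  push_cast at h2
  linarith

end Clutter

/-! ### The double star -/

namespace Clutter

variable (t₁ t₂ : ℕ)

variable {t₁ t₂} in
/-- The center of the star that has the leaf `s`. -/
def doubleStarCenter (s : Fin t₁ ⊕ Fin t₂) : Fin 2 :=
  Sum.elim (fun _ => 0) (fun _ => 1) s

/-- The edge of the double star that ends in the leaf `s`. -/
def doubleStarEdge : Fin t₁ ⊕ Fin t₂ ↪ Finset (Fin 2 ⊕ (Fin t₁ ⊕ Fin t₂)) where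
  toFun s := {Sum.inl (doubleStarCenter s), Sum.inr s}
  inj' s s' h := by
    have hs : Sum.inr s ∈ ({Sum.inl (doubleStarCenter s), Sum.inr s} :
        Finset (Fin 2 ⊕ (Fin t₁ ⊕ Fin t₂))) := by
      simp
    simpa using (Finset.ext_iff.1 h _).1 hs

theorem doubleStarEdge_apply (s : Fin t₁ ⊕ Fin t₂) :
    doubleStarEdge t₁ t₂ s = {Sum.inl (doubleStarCenter s), Sum.inr s} :=
  rfl

theorem inr_mem_doubleStarEdge {s s' : Fin t₁ ⊕ Fin t₂} :
    Sum.inr s ∈ doubleStarEdge t₁ t₂ s' ↔ s = s' := by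
  simp [doubleStarEdge_apply]

theorem edges_doubleStar :
    (doubleStar t₁ t₂).edges = Finset.univ.map (doubleStarEdge t₁ t₂) := by
  ext F
  simp [doubleStar, doubleStarEdge_apply, doubleStarCenter, eq_comm]

theorem isPureOfDegree_doubleStar : (doubleStar t₁ t₂).IsPureOfDegree 2 := by
  intro F hF
  rw [edges_doubleStar, Finset.mem_map] at hF
  obtain ⟨s, -, rfl⟩ := hF
  exact Finset.card_pair (by simp)

theorem card_edges_doubleStar : (doubleStar t₁ t₂).edges.card = t₁ + t₂ := by
  rw [edges_doubleStar, Finset.card_map, Finset.card_univ, Fintype.card_sum, Fintype.card_fin,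
    Fintype.card_fin]

/-- The leaf of an edge lies in no other edge. -/
theorem isMinimal_taylorComplex_doubleStar (k : Type*) [Field k] :
    ((doubleStar t₁ t₂).taylorComplex k).IsMinimal := by
  refine isMinimal_taylorComplex k _ fun F hF => ?_
  rw [edges_doubleStar, Finset.mem_map] at hF
  obtain ⟨s, -, rfl⟩ := hF
  refine ⟨Sum.inr s, (inr_mem_doubleStarEdge t₁ t₂).2 rfl, fun F' hF' h => ?_⟩
  rw [edges_doubleStar, Finset.mem_map] at hF'
  obtain ⟨s', -, rfl⟩ := hF'
  rw [(inr_mem_doubleStarEdge t₁ t₂).1 h]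

/-- The lcm of a set of edges of the double star involves their leaves and the centers
of the stars that the set meets. -/
theorem degree_sup_map_doubleStarEdge (U : Finset (Fin t₁ ⊕ Fin t₂)) :
    ((U.map (doubleStarEdge t₁ t₂)).sup sqfreeExponent).degree =
      (U.image doubleStarCenter).card + U.card := by
  have h : U.biUnion (doubleStarEdge t₁ t₂) =
      (U.image doubleStarCenter).disjSum U := by
    ext x
    rcases x with x | x <;> simp [doubleStarEdge_apply, eq_comm]
  rw [Finset.sup_map]
  have h2 := sup_sqfreeExponent U (doubleStarEdge t₁ t₂)
  rw [← Finset.card_disjSum, ← h, ← degree_sqfreeExponent, ← h2]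
  rfl

/-- The triples of edges with an lcm of degree `5` are those that meet both stars. -/
theorem taylorBetti_doubleStar :
    (doubleStar t₁ t₂).taylorBetti 2 (3 * 2 - 1) + (t₁.choose 3 + t₂.choose 3) =
      (t₁ + t₂).choose 3 := by
  set P := (Finset.univ : Finset (Fin t₁ ⊕ Fin t₂)).powersetCard 3 with hP
  have h1 : (doubleStar t₁ t₂).taylorBetti 2 (3 * 2 - 1) =
      (P.filter fun U => (U.image doubleStarCenter).card = 2).card := by
    rw [taylorBetti, edges_doubleStar, Finset.powersetCard_map, Finset.filter_map, Finset.card_map]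
    refine congrArg _ (Finset.filter_congr fun U hU => ?_)
    rw [Function.comp_apply]
    change (((U.map (doubleStarEdge t₁ t₂)).sup sqfreeExponent).degree : ℤ) = _ ↔ _
    rw [degree_sup_map_doubleStarEdge, (Finset.mem_powersetCard.1 hU).2]
    push_cast
    omega
  have h2 : (P.filter fun U => ¬ (U.image doubleStarCenter).card = 2) =
      ((Finset.univ : Finset (Fin t₁)).map Function.Embedding.inl).powersetCard 3 ∪
        ((Finset.univ : Finset (Fin t₂)).map Function.Embedding.inr).powersetCard 3 := by
    ext U
    simp only [hP, Finset.mem_filter, Finset.mem_union, Finset.mem_powersetCard,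
      Finset.subset_univ, and_true, and_comm (b := U.card = 3), ← and_or_left]
    refine and_congr_right fun hU => ⟨fun h => ?_, ?_⟩
    · by_contra hc
      rw [not_or, Finset.not_subset, Finset.not_subset] at hc
      obtain ⟨⟨x, hx, hx'⟩, y, hy, hy'⟩ := hc
      have huniv : U.image doubleStarCenter = Finset.univ := by
        refine Finset.eq_univ_of_forall fun i => ?_
        fin_cases i
        · rcases y with y | y
          · exact Finset.mem_image.2 ⟨_, hy, rfl⟩
          · simp at hy'
        · rcases x with x | x
          · simp at hx'
          · exact Finset.mem_image.2 ⟨_, hx, rfl⟩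
      exact h (by rw [huniv]; rfl)
    · have hle : ∀ i, (∀ s ∈ U, doubleStarCenter s = i) →
          ¬ (U.image doubleStarCenter).card = 2 := by
        intro i hi hc
        have := Finset.card_le_card (Finset.image_subset_iff.2 fun s hs =>
          Finset.mem_singleton.2 (hi s hs))
        rw [hc, Finset.card_singleton] at this
        omega
      rintro (h | h)
      · refine hle 0 fun s hs => ?_
        obtain ⟨i, -, rfl⟩ := Finset.mem_map.1 (h hs)
        rfl
      · refine hle 1 fun s hs => ?_
        obtain ⟨i, -, rfl⟩ := Finset.mem_map.1 (h hs)
        rfl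
  have h3 : Disjoint
      (((Finset.univ : Finset (Fin t₁)).map Function.Embedding.inl).powersetCard 3)
      (((Finset.univ : Finset (Fin t₂)).map (Function.Embedding.inr (α := Fin t₁))).powersetCard
        3) := by
    refine Finset.disjoint_left.2 fun U hU hU' => ?_
    rw [Finset.mem_powersetCard] at hU hU'
    obtain ⟨s, hs⟩ : U.Nonempty := Finset.card_pos.1 (by omega)
    obtain ⟨i, -, rfl⟩ := Finset.mem_map.1 (hU.1 hs)
    simpa using hU'.1 hs
  have h4 : P.card = (t₁ + t₂).choose 3 := by
    rw [hP, Finset.card_powersetCard, Finset.card_univ, Fintype.card_sum, Fintype.card_fin,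
      Fintype.card_fin]
  rw [h1, ← h4, ← Finset.card_filter_add_card_filter_not (s := P) fun U =>
    (U.image doubleStarCenter).card = 2, h2, Finset.card_union_of_disjoint h3,
    Finset.card_powersetCard, Finset.card_powersetCard, Finset.card_map, Finset.card_map,
    Finset.card_univ, Finset.card_univ,
    Fintype.card_fin, Fintype.card_fin]

end Clutter

theorem theorem4p1 (k : Type*) [Field k] (t t₁ t₂ : ℕ)
    (hpart : IsNearlyEvenPartition t ![t₁, t₂]) :
    -- the bound, for the Betti number and for the Taylor Betti number
    (∀ (σ : Type*) [Finite σ] (d : ℕ) (G : Clutter σ) (I : Ideal (MvPolynomial σ k)),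
      G.IsPureOfDegree d → G.edges.card = t → I = G.edgeIdeal k →
        (∀ R : MinimalGradedFreeResolution I,
          (R.betti 2 (3 * (d : ℤ) - 1) : ℤ) ≤
            (t.choose 3 : ℤ) - (t₁.choose 3 : ℤ) - (t₂.choose 3 : ℤ)) ∧
        (G.taylorBetti 2 (3 * (d : ℤ) - 1) : ℤ) ≤
          (t.choose 3 : ℤ) - (t₁.choose 3 : ℤ) - (t₂.choose 3 : ℤ)) ∧
    -- the bound is attained, in degree two
    ((Clutter.doubleStar t₁ t₂).IsPureOfDegree 2 ∧
      (Clutter.doubleStar t₁ t₂).edges.card = t ∧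
      Nonempty (MinimalGradedFreeResolution ((Clutter.doubleStar t₁ t₂).edgeIdeal k)) ∧
      (∀ R : MinimalGradedFreeResolution ((Clutter.doubleStar t₁ t₂).edgeIdeal k),
        (R.betti 2 (3 * 2 - 1) : ℤ) =
          (t.choose 3 : ℤ) - (t₁.choose 3 : ℤ) - (t₂.choose 3 : ℤ)) ∧
      ((Clutter.doubleStar t₁ t₂).taylorBetti 2 (3 * 2 - 1) : ℤ) =
        (t.choose 3 : ℤ) - (t₁.choose 3 : ℤ) - (t₂.choose 3 : ℤ)) := by
  have hsum : t₁ + t₂ = t := by simpa using hpart.1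
  have hstar : ((Clutter.doubleStar t₁ t₂).taylorBetti 2 (3 * 2 - 1) : ℤ) =
      (t.choose 3 : ℤ) - (t₁.choose 3 : ℤ) - (t₂.choose 3 : ℤ) := by
    rw [← hsum, ← Clutter.taylorBetti_doubleStar]
    push_cast
    ring
  have hmin := Clutter.isMinimal_taylorComplex_doubleStar t₁ t₂ k
  refine ⟨?_, Clutter.isPureOfDegree_doubleStar t₁ t₂,
    (Clutter.card_edges_doubleStar t₁ t₂).trans hsum,
    hmin.nonempty_minimalGradedFreeResolution (Clutter.resolves_taylorComplex k _),
    fun R => ?_, hstar⟩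
  · rintro σ _ d G I hd rfl rfl
    have hT := Clutter.taylorBetti_two_le hd hpart
    exact ⟨fun R => (Nat.cast_le.2 (G.betti_le_taylorBetti R _ _)).trans hT, hT⟩
  · rw [Clutter.betti_eq_taylorBetti _ hmin, hstar]
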